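/- For a rational parameter $t$ let $\phi_t(x)=\dfrac{x-t}{x^3+1}$, and consider the family $\phi:\mathbb{P}^1\dashrightarrow \mathrm{Rat}_3$, $t\mapsto\phi_t$, of rational maps of $\mathbb{P}^1$ of degree $3$; in homogeneous coordinates $[a:b]\mapsto [\,bXY^2-aY^3 : b(X^3+Y^3)\,]$. Let $I_\phi(\mathbb{Q})$ be the set of $t\in\mathbb{P}^1(\mathbb{Q})$ such that $\phi_t$ is defined as an element of $\mathrm{Rat}_3$ (the two cubic forms have nonzero resultant) and $\phi_t^2=\phi_t\circ\phi_t\notin\overline{\mathbb{Q}}[x]$. For a nonconstant $\beta\in\mathbb{Q}(t)$, viewed as a morphism $\mathbb{P}^1\to\mathbb{P}^1$, write $\beta_t=\beta(t)\in\mathbb{P}^1(\mathbb{Q})$, let $h$ be the absolute logarithmic height on $\mathbb{P}^1(\mathbb{Q})$, and for a real number $B$ let $$I_{\phi}(\mathbb{Q},B)=\{t\in I_\phi(\mathbb{Q}) : h(\beta_t)\le B\}.$$ Let $\mathcal{O}_{\phi_t}(\beta_t)=\{\beta_t,\phi_t(\beta_t),\phi_t^2(\beta_t),\dots\}\subseteq\mathbb{P}^1(\mathbb{Q})$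 be the forward orbit, and put $$\overline{\mathrm{Avg}}(\phi,\beta,\mathbb{Z})=\limsup_{B\to\infty}\frac{\sum_{t\in I_{\phi}(\mathbb{Q},B)}\#\big(\mathcal{O}_{\phi_t}(\beta_t)\cap\mathbb{Z}\big)}{\#I_{\phi}(\mathbb{Q},B)}\in[0,\infty].$$ Theorem. One has $I_\phi(\mathbb{Q})=\mathbb{P}^1(\mathbb{Q})\setminus\{-1,\infty\}$. If $\beta\in\mathbb{Q}(t)$ has $\deg(\beta)\ge 3$ (the degree of $\beta$ as a map $\mathbb{P}^1\to\mathbb{P}^1$), then $I_\phi(\mathbb{Q},B)$ is finite for every real $B$, and $$\overline{\mathrm{Avg}}(\phi,\beta,\mathbb{Z})=0.$$ -/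

import Mathlib

open Polynomial OnePoint Filter

noncomputable section

namespace OrbitAverage

/-- The map `[F : G]` of the projective line `ℙ¹(K) = K ∪ {∞}` given in the affine coordinate
`x = X / Y` by the degree `d` homogenizations of two polynomials `F`, `G` of degree at most `d`
without common zero on `ℙ¹`. In particular poles are sent to `∞`, and `∞ = [1 : 0]` is sent to
`[a_d : b_d]`, where `a_d`, `b_d` are the coefficients of `x ^ d` in `F`, `G`. -/
def evalP1 {K : Type*} [Field K] [DecidableEq K] (d : ℕ) (F G : K[X]) : OnePoint K → OnePoint K
  | ∞ => if G.coeff d = 0 then ∞ else ((F.coeff d / G.coeff d : K) : OnePoint K)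
  | OnePoint.some x => if G.eval x = 0 then ∞ else ((F.eval x / G.eval x : K) : OnePoint K)

/-- The pair `(F, G)` represents a point of `Rat_d ⊆ ℙ^{2d+1}`: both polynomials have degree at
most `d`, and the resultant of the associated binary forms of degree `d` is nonzero. -/
def IsRat {K : Type*} [Field K] (d : ℕ) (F G : K[X]) : Prop :=
  F.natDegree ≤ d ∧ G.natDegree ≤ d ∧ resultant F G d d ≠ 0

/-- The second iterate `φ(φ(x))` of `φ = F / G`, as an element of the field `K̄(x)` of rational
functions over an algebraic closure of `K`. -/
def secondIterate {K : Type*} [Field K] (F G : K[X]) : RatFunc (AlgebraicClosure K) :=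
  let ι : K →+* RatFunc (AlgebraicClosure K) :=
    RatFunc.C.comp (algebraMap K (AlgebraicClosure K))
  let φ : RatFunc (AlgebraicClosure K) := F.eval₂ ι RatFunc.X / G.eval₂ ι RatFunc.X
  F.eval₂ ι φ / G.eval₂ ι φ

/-- `I_{ℙ¹, φ}(ℚ)` for a family `φ : ℙ¹ ⇢ Rat_d`, `P ↦ φ_P`, the map `φ_P = [F : G]` being given
by the pair `φ P = (F, G)`: the rational points `P` of the base at which `φ_P ∈ Rat_d` is defined
and the second iterate of `φ_P` is not a polynomial over `ℚ̄`. -/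
def goodParams (d : ℕ) (φ : OnePoint ℚ → ℚ[X] × ℚ[X]) : Set (OnePoint ℚ) :=
  {P | IsRat d (φ P).1 (φ P).2 ∧
    secondIterate (φ P).1 (φ P).2 ∉
      Set.range (algebraMap (AlgebraicClosure ℚ)[X] (RatFunc (AlgebraicClosure ℚ)))}

/-- The degree of a rational function `β ∈ ℚ(t)`, as a map `ℙ¹ → ℙ¹`. -/
def degree (β : RatFunc ℚ) : ℕ := max β.num.natDegree β.denom.natDegree

/-- The value `β_P ∈ ℙ¹(ℚ)` of the morphism `β : ℙ¹ → ℙ¹` at `P ∈ ℙ¹(ℚ)`. -/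
def value (β : RatFunc ℚ) (P : OnePoint ℚ) : OnePoint ℚ :=
  evalP1 (degree β) β.num β.denom P

/-- The absolute logarithmic height on `ℙ¹(ℚ)`. -/
def height (P : OnePoint ℚ) : ℝ := (OnePoint.equivProjectivization ℚ P).logHeight

/-- The points `P` of `I_{ℙ¹, φ}(ℚ)` of height at most `B`, for the height `h(β_P)` on the base
that is associated to `β`. -/
def goodParamsLE (d : ℕ) (φ : OnePoint ℚ → ℚ[X] × ℚ[X]) (β : RatFunc ℚ) (B : ℝ) :
    Set (OnePoint ℚ) :=
  {P ∈ goodParams d φ | height (value β P) ≤ B}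

/-- The forward orbit `{b, f b, f (f b), …}`. -/
def orbit {α : Type*} (f : α → α) (b : α) : Set α := Set.range fun n : ℕ => f^[n] b

/-- The integers, as a subset of `ℙ¹(ℚ)`. -/
def integers : Set (OnePoint ℚ) := Set.range fun n : ℤ => ((n : ℚ) : OnePoint ℚ)

/-- The number (possibly `∞`) of integers in the orbit of `β_P` under `φ_P`. -/
def integersInOrbit (d : ℕ) (φ : OnePoint ℚ → ℚ[X] × ℚ[X]) (β : RatFunc ℚ) (P : OnePoint ℚ) :
    ℕ∞ :=
  (orbit (evalP1 d (φ P).1 (φ P).2) (value β P) ∩ integers).encard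

/-- The average number of integers in orbits in the family `(ℙ¹, φ, β)` over `ℚ`: the limsup, as
`B → ∞`, of the mean of `#(O_{φ_P}(β_P) ∩ ℤ)` over the points `P` of `I_{ℙ¹, φ}(ℚ)` of height at
most `B`. It is taken in `[0, ∞]`. -/
def average (d : ℕ) (φ : OnePoint ℚ → ℚ[X] × ℚ[X]) (β : RatFunc ℚ) : ENNReal :=
  limsup (fun B : ℝ =>
    (∑' P : goodParamsLE d φ β B, (integersInOrbit d φ β P : ENNReal)) /
      ((goodParamsLE d φ β B).encard : ENNReal)) atTop

/-- The family `φ_t(x) = (x - t) / (x ^ 3 + 1)`. In homogeneous coordinates `t = [a : b]` on the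
base it is `[b x - a : b (x ^ 3 + 1)]`, so that its value at `t = ∞ = [1 : 0]` is the degenerate
pair `[-1 : 0]`. -/
def cubicFamily : OnePoint ℚ → ℚ[X] × ℚ[X]
  | ∞ => (-1, 0)
  | OnePoint.some t => (X - C t, X ^ 3 + 1)

end OrbitAverage

end

/-! Write `H` for the multiplicative height and `T = H(t)`, with `t ≠ -1`. Two facts control the
orbits: `H(P)^3 ≤ 32 T^4 H(φ_t(P))` (`expHeight_pow_le_cubicMap`), and `φ_t(P)` is not an integer
once `H(P) ≥ 6 T^2` (`cubicMap_notMem_integers`). The first makes the threshold `6 T^2` stable under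
`φ_t`, so an orbit starting above it contains no integer except possibly its starting point. Since
`H(β_t)` is comparable to `T^deg β` and `deg β ≥ 3`, all but finitely many `t` start above the
threshold. Each of the others contributes finitely many integers, so the numerator of the average is
at most a constant plus the number of `t` with `β_t` integral. Among `t` of height at most `n` these
number `O(n)` (`exists_ncard_value_mem_integers_le`), whereas the number of all `t ≠ -1` of height
at most `n` is superlinear (`mul_half_le_ncard_mulHeight_le`); hence the quotient tends to `0`. The
good parameters come from `Res = t^3 + 1` and from comparing degrees and values at `-1` in the
second iterate. -/

namespace OrbitAverage

/-! ### Heights in homogeneous coordinates -/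

/-- The point `[u : v]` of `ℙ¹(ℚ)`. -/
noncomputable def ratio (u v : ℚ) : OnePoint ℚ := if v = 0 then ∞ else ((u / v : ℚ) : OnePoint ℚ)

/-- The absolute multiplicative height on `ℙ¹(ℚ)`. -/
noncomputable def expHeight (P : OnePoint ℚ) : ℝ :=
  (OnePoint.equivProjectivization ℚ P).mulHeight

lemma height_eq_log (P : OnePoint ℚ) : height P = Real.log (expHeight P) :=
  Projectivization.logHeight_eq_log_mulHeight _

lemma one_le_expHeight (P : OnePoint ℚ) : 1 ≤ expHeight P := Projectivization.one_le_mulHeight _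

lemma height_le_iff (P : OnePoint ℚ) (B : ℝ) : height P ≤ B ↔ expHeight P ≤ Real.exp B := by
  rw [height_eq_log, Real.log_le_iff_le_exp (zero_lt_one.trans_le (one_le_expHeight P))]

lemma expHeight_ratio {u v : ℚ} (h : ![u, v] ≠ 0) :
    expHeight (ratio u v) = Height.mulHeight ![u, v] := by
  have : ratio u v = (OnePoint.equivProjectivization ℚ).symm (.mk ℚ ![u, v] h) := by
    rw [OnePoint.equivProjectivization_symm_apply_mk]
    simp [ratio, div_eq_inv_mul]
  rw [this, expHeight, Equiv.apply_symm_apply, Projectivization.mulHeight_mk]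

lemma expHeight_coe (t : ℚ) : expHeight (t : OnePoint ℚ) = Height.mulHeight₁ t := by
  have : (t : OnePoint ℚ) = ratio t 1 := by simp [ratio]
  rw [this, expHeight_ratio (by simp), Height.mulHeight₁_eq_mulHeight]

lemma ratio_mul_left {c : ℚ} (hc : c ≠ 0) (u v : ℚ) : ratio (c * u) (c * v) = ratio u v := by
  by_cases hv : v = 0
  · simp [ratio, hv]
  · simp [ratio, hv, hc, mul_div_mul_left]

lemma mulHeight_pair_intCast {p q : ℤ} (h : IsCoprime p q) :
    Height.mulHeight ![(p : ℚ), (q : ℚ)] = max |p| |q| := by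
  have : (.univ : Finset (Fin 2)).gcd ![p, q] = 1 := by
    simp [Finset.univ_fin2, (normalize_associated q).gcd_eq_right, ← Int.coe_gcd,
      Int.isCoprime_iff_gcd_eq_one.mp h]
  have h2 := Rat.mulHeight_eq_max_abs_of_gcd_eq_one this
  have h3 : ((↑) : ℤ → ℚ) ∘ ![p, q] = ![(p : ℚ), (q : ℚ)] := by
    ext i; fin_cases i <;> simp
  rw [h3] at h2
  rw [h2, Int.cast_inj]
  refine le_antisymm (ciSup_le fun i ↦ ?_) (max_le ?_ ?_)
  · fin_cases i <;> simp
  · exact Finite.le_ciSup_of_le 0 <| by simp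
  · exact Finite.le_ciSup_of_le 1 <| by simp

/-- Every point of `ℙ¹(ℚ)` is `[p : q]` with coprime integers `p`, `q`, the larger of which
is its height. -/
lemma exists_eq_ratio_intCast (P : OnePoint ℚ) :
    ∃ p q : ℤ, IsCoprime p q ∧ P = ratio p q ∧ expHeight P = (max |p| |q| : ℤ) := by
  have key (p q : ℤ) (h : IsCoprime p q) : expHeight (ratio p q) = (max |p| |q| : ℤ) := by
    have h2 := mulHeight_pair_intCast h
    rw [expHeight_ratio, h2]
    intro h0
    have hp : p = 0 := by simpa using congrFun h0 0
    have hq : q = 0 := by simpa using congrFun h0 1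
    subst hp hq
    exact not_isCoprime_zero_zero h
  induction P using OnePoint.rec with
  | infty =>
    have : (∞ : OnePoint ℚ) = ratio (1 : ℤ) (0 : ℤ) := by simp [ratio]
    exact ⟨1, 0, isCoprime_one_left, this, this ▸ key 1 0 isCoprime_one_left⟩
  | coe x =>
    have hc : IsCoprime x.num (x.den : ℤ) := Rat.isCoprime_num_den x
    have : (x : OnePoint ℚ) = ratio (x.num : ℤ) (x.den : ℤ) := by
      have := x.den_nz
      simp [ratio, Rat.num_div_den]
    exact ⟨x.num, x.den, hc, this, by rw [this]; exact key _ _ hc⟩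

/-- The height of a point with integral homogeneous coordinates `N`, `D`. -/
lemma max_abs_le_mul_expHeight_ratio {N D g : ℤ} (hND : N ≠ 0 ∨ D ≠ 0) (hg : (Int.gcd N D : ℤ) ≤ g) :
    ((max |N| |D| : ℤ) : ℝ) ≤ g * expHeight (ratio N D) := by
  have hpos : 0 < Int.gcd N D := Int.gcd_pos_iff.mpr hND
  obtain ⟨N', D', hc, hN, hD⟩ := Int.exists_gcd_one hpos
  set e := Int.gcd N D
  have he : (0 : ℤ) < e := by exact_mod_cast hpos
  have hne : ![(N' : ℚ), (D' : ℚ)] ≠ 0 := by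
    intro h0
    have hp : N' = 0 := by simpa using congrFun h0 0
    have hq : D' = 0 := by simpa using congrFun h0 1
    subst hp hq
    simp at hc
  have h1 : expHeight (ratio N D) = (max |N'| |D'| : ℤ) := by
    have : ratio (N : ℚ) (D : ℚ) = ratio (N' : ℚ) (D' : ℚ) := by
      rw [← ratio_mul_left (c := (e : ℚ)) (by exact_mod_cast he.ne') (N' : ℚ), hN, hD]
      simp only [Int.cast_mul, Int.cast_natCast, mul_comm]
    rw [this, expHeight_ratio hne, mulHeight_pair_intCast (Int.isCoprime_iff_gcd_eq_one.mpr hc)]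
  rw [h1]
  have : max |N| |D| = e * max |N'| |D'| := by
    rw [hN, hD, abs_mul, abs_mul, abs_of_pos he, ← max_mul_of_nonneg _ _ he.le, mul_comm]
  rw [this]
  exact_mod_cast mul_le_mul_of_nonneg_right hg (le_max_of_le_left (abs_nonneg _))

lemma finite_setOf_expHeight_le (B : ℝ) : {P : OnePoint ℚ | expHeight P ≤ B}.Finite := by
  refine (((NumberField.finite_setOfPred_mulHeight₁_le ℚ B).image
    ((↑) : ℚ → OnePoint ℚ)).insert ∞).subset fun P hP ↦ ?_
  induction P using OnePoint.rec with
  | infty => exact Or.inl rfl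
  | coe x => exact Or.inr ⟨x, by simpa [expHeight_coe] using hP, rfl⟩

/-! ### Heights of values of coprime pairs of polynomials -/

/-- If `F`, `G` are coprime of maximal degree `d`, every polynomial of degree at most `2 d` is
a combination of `F` and `G` with coefficients of degree at most `d`. -/
lemma exists_combination_of_isCoprime {K : Type*} [Field K] {F G : K[X]} (h : IsCoprime F G)
    (hd : G.natDegree ≤ F.natDegree) (hF : F ≠ 0) {p : K[X]} (hp : p.natDegree ≤ 2 * F.natDegree) :
    ∃ u v : K[X], u.natDegree ≤ F.natDegree ∧ v.natDegree ≤ F.natDegree ∧ u * F + v * G = p := by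
  obtain ⟨U, V, hUV⟩ := h
  have hr : ((p * V) % F).natDegree ≤ F.natDegree :=
    natDegree_le_natDegree (EuclideanDomain.mod_lt _ hF).le
  have hmul : (p * U + (p * V) / F * G) * F + (p * V) % F * G = p := by
    have h1 := EuclideanDomain.div_add_mod (p * V) F
    calc _ = p * U * F + (F * (p * V / F) + p * V % F) * G := by ring
      _ = p * (U * F + V * G) := by rw [h1]; ring
      _ = p := by rw [hUV, mul_one]
  refine ⟨_, _, ?_, hr, hmul⟩
  by_cases h0 : p * U + (p * V) / F * G = 0
  · simp [h0]
  -- Only the coefficient of `G` was reduced modulo `F`; the degree of the other one is read off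
  -- from its product with `F`.
  have h2 : ((p * U + (p * V) / F * G) * F).natDegree ≤ 2 * F.natDegree := by
    rw [eq_sub_of_add_eq hmul]
    refine (natDegree_sub_le _ _).trans (max_le hp (natDegree_mul_le.trans ?_))
    omega
  rw [natDegree_mul h0 hF] at h2
  omega

lemma exists_combination_of_isCoprime' {K : Type*} [Field K] {F G : K[X]} (h : IsCoprime F G)
    {p : K[X]} (hp : p.natDegree ≤ 2 * max F.natDegree G.natDegree) :
    ∃ u v : K[X], u.natDegree ≤ max F.natDegree G.natDegree ∧
      v.natDegree ≤ max F.natDegree G.natDegree ∧ u * F + v * G = p := by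
  rcases le_total G.natDegree F.natDegree with hd | hd
  · rw [max_eq_left hd] at hp ⊢
    by_cases hF : F = 0
    · subst hF
      have hG : IsUnit G := isCoprime_zero_left.mp h
      obtain ⟨w, hw⟩ := hG.exists_left_inv
      obtain ⟨r, hr, rfl⟩ := Polynomial.isUnit_iff.mp hG
      refine ⟨0, p * C r⁻¹, by simp, ?_, ?_⟩
      · refine natDegree_mul_le.trans ?_
        simpa using hp
      · rw [mul_zero, zero_add, mul_assoc, ← C_mul, inv_mul_cancel₀ hr.ne_zero, C_1, mul_one]
    · exact exists_combination_of_isCoprime h hd hF hp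
  · rw [max_eq_right hd] at hp ⊢
    by_cases hG : G = 0
    · subst hG
      obtain ⟨r, hr, rfl⟩ := Polynomial.isUnit_iff.mp (isCoprime_zero_right.mp h)
      refine ⟨p * C r⁻¹, 0, ?_, by simp, ?_⟩
      · refine natDegree_mul_le.trans ?_
        simpa using hp
      · rw [zero_mul, add_zero, mul_assoc, ← C_mul, inv_mul_cancel₀ hr.ne_zero, C_1, mul_one]
    · obtain ⟨u, v, hu, hv, huv⟩ := exists_combination_of_isCoprime h.symm hd hG hp
      exact ⟨v, u, hv, hu, by rw [add_comm]; exact huv⟩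

lemma eval_homogenize_pair {K : Type*} [Field K] {p : K[X]} {n : ℕ} (hn : p.natDegree ≤ n)
    (t : K) : MvPolynomial.eval ![t, 1] (p.homogenize n) = p.eval t := by
  rw [eval_homogenize hn _ (by simp)]; simp

/-- Effective Nullstellensatz: the forms `X^(2d)` and `Y^(2d)` are combinations of the homogenized
`F`, `G` with coefficients of degree `d`, so little cancellation is possible. In the affine
coordinate they are `X^(2d)` and `1`. -/
lemma exists_mulHeight_eval_ge {F G : ℚ[X]} (h : IsCoprime F G) :
    ∃ c > 0, ∀ t : ℚ, c * Height.mulHeight₁ t ^ max F.natDegree G.natDegree ≤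
      Height.mulHeight ![F.eval t, G.eval t] := by
  set d := max F.natDegree G.natDegree with hd
  obtain ⟨u, v, hu, hv, huv⟩ := exists_combination_of_isCoprime' h (p := X ^ (2 * d)) (by simp [hd])
  obtain ⟨u', v', hu', hv', huv'⟩ := exists_combination_of_isCoprime' h (p := 1) (by simp)
  let r : Fin 2 × Fin 2 → ℚ[X] := fun a ↦ (![![u, v], ![u', v']] a.1) a.2
  have hr (a) : (r a).natDegree ≤ d := by
    obtain ⟨i, j⟩ := a
    fin_cases i <;> fin_cases j <;> simpa [r]
  obtain ⟨c, hc, H⟩ := Height.mulHeight_eval_ge' (K := ℚ) (N := d)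
    (q := fun a ↦ (r a).homogenize d) (fun a ↦ isHomogeneous_homogenize _)
  refine ⟨c, hc, fun t ↦ ?_⟩
  have := H ![F.homogenize d, G.homogenize d] (x := ![t, 1]) ?_
  · rw [← Height.mulHeight₁_eq_mulHeight] at this
    convert this using 2
    ext i
    fin_cases i
    · simp [eval_homogenize_pair (le_max_left F.natDegree G.natDegree), hd]
    · simp [eval_homogenize_pair (le_max_right F.natDegree G.natDegree), hd]
  · intro k
    have hF := eval_homogenize_pair (le_max_left F.natDegree G.natDegree) t
    have hG := eval_homogenize_pair (le_max_right F.natDegree G.natDegree) t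
    rw [← hd] at hF hG
    simp only [Fin.sum_univ_two, eval_homogenize_pair (hr _)]
    fin_cases k
    · simpa [r, hF, hG, ← two_mul] using congr(eval t $huv)
    · simpa [r, hF, hG] using congr(eval t $huv')

lemma exists_mulHeight_eval_le (F G : ℚ[X]) :
    ∃ C > 0, ∀ t : ℚ, Height.mulHeight ![F.eval t, G.eval t] ≤
      C * Height.mulHeight₁ t ^ max F.natDegree G.natDegree := by
  set d := max F.natDegree G.natDegree with hd
  obtain ⟨C, hC, H⟩ := Height.mulHeight_eval_le' (K := ℚ) (N := d)
    (p := ![F.homogenize d, G.homogenize d])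
    (fun i ↦ by fin_cases i <;> exact isHomogeneous_homogenize _)
  refine ⟨C, hC, fun t ↦ ?_⟩
  have := H ![t, 1]
  rw [← Height.mulHeight₁_eq_mulHeight] at this
  convert this using 2
  ext i
  fin_cases i
  · simp [eval_homogenize_pair (le_max_left F.natDegree G.natDegree), hd]
  · simp [eval_homogenize_pair (le_max_right F.natDegree G.natDegree), hd]

lemma value_coe (β : RatFunc ℚ) (t : ℚ) :
    value β (t : OnePoint ℚ) = ratio (β.num.eval t) (β.denom.eval t) := rfl

lemma pair_eval_ne_zero {F G : ℚ[X]} (h : IsCoprime F G) (t : ℚ) :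
    ![F.eval t, G.eval t] ≠ 0 := by
  intro h0
  obtain ⟨u, v, huv⟩ := h
  have hF : F.eval t = 0 := by simpa using congrFun h0 0
  have hG : G.eval t = 0 := by simpa using congrFun h0 1
  simpa [hF, hG] using congr(eval t $huv)

lemma expHeight_value_coe (β : RatFunc ℚ) (t : ℚ) :
    expHeight (value β (t : OnePoint ℚ)) =
      Height.mulHeight ![β.num.eval t, β.denom.eval t] := by
  rw [value_coe, expHeight_ratio (pair_eval_ne_zero β.isCoprime_num_denom t)]

/-! ### Height growth and integral values of the cubic map -/

/-- The map `φ_t` of the cubic family on `ℙ¹(ℚ)`. -/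
noncomputable abbrev cubicMap (t : ℚ) : OnePoint ℚ → OnePoint ℚ := evalP1 3 (X - C t) (X ^ 3 + 1)

lemma cubicMap_ratio (a b p q : ℤ) (hb : b ≠ 0) (hpq : p ≠ 0 ∨ q ≠ 0) :
    cubicMap (a / b : ℚ) (ratio p q) =
      ratio (q ^ 2 * (b * p - a * q) : ℤ) (b * (p ^ 3 + q ^ 3) : ℤ) := by
  have hb' : (b : ℚ) ≠ 0 := by exact_mod_cast hb
  by_cases hq : q = 0
  · subst hq
    have hp : (p : ℚ) ≠ 0 := by simpa using hpq
    have h0 : ratio (p : ℚ) ((0 : ℤ) : ℚ) = ∞ := by simp [ratio]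
    have h1 : (1 : ℚ[X]).coeff 3 = 0 := by simp [coeff_one]
    have h2 : (X : ℚ[X]).coeff 3 = 0 := by simp [coeff_X]
    have h3 : (C (a / b : ℚ)).coeff 3 = 0 := by simp
    rw [h0]
    simp [cubicMap, evalP1, ratio, hb', hp, h1, h2, h3]
  · have hq' : (q : ℚ) ≠ 0 := by exact_mod_cast hq
    have h0 : ratio (p : ℚ) (q : ℚ) = ((p / q : ℚ) : OnePoint ℚ) := by simp [ratio, hq]
    rw [h0]
    change ratio ((X - C (a / b : ℚ)).eval (p / q : ℚ)) ((X ^ 3 + 1 : ℚ[X]).eval (p / q : ℚ)) = _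
    rw [← ratio_mul_left (c := b * (q : ℚ) ^ 3) (by positivity)]
    congr 1
    · simp; field_simp
    · simp; field_simp

lemma isCoprime_cube_add_cube {R : Type*} [CommRing R] {p q : R} (h : IsCoprime p q) :
    IsCoprime (p ^ 3 + q ^ 3) q := by
  rw [pow_succ' q 2]
  exact (IsCoprime.pow_left h).add_mul_left_left _

/-- Eliminating `p` through `(bp)^3 - (aq)^3` shows that the gcd divides `(a^3 + b^3) q^5`; as `q^5`
is coprime to `p^3 + q^3`, the power of `q` can be removed at the cost of a factor `b`. -/
lemma gcd_cubic_dvd {a b p q : ℤ} (hpq : IsCoprime p q) :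
    (Int.gcd (q ^ 2 * (b * p - a * q)) (b * (p ^ 3 + q ^ 3)) : ℤ) ∣ b * (a ^ 3 + b ^ 3) := by
  set g : ℤ := (Int.gcd (q ^ 2 * (b * p - a * q)) (b * (p ^ 3 + q ^ 3)) : ℤ)
  have hN : g ∣ q ^ 2 * (b * p - a * q) := Int.gcd_dvd_left ..
  have hD : g ∣ b * (p ^ 3 + q ^ 3) := Int.gcd_dvd_right ..
  have hq : g ∣ (a ^ 3 + b ^ 3) * q ^ 5 := by
    have : (a ^ 3 + b ^ 3) * q ^ 5 = (q ^ 2 * b ^ 2) * (b * (p ^ 3 + q ^ 3)) -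
        (b ^ 2 * p ^ 2 + a * b * p * q + a ^ 2 * q ^ 2) * (q ^ 2 * (b * p - a * q)) := by ring
    rw [this]
    exact dvd_sub (hD.mul_left _) (hN.mul_left _)
  have hc : IsCoprime (p ^ 3 + q ^ 3) (q ^ 5) := (isCoprime_cube_add_cube hpq).pow_right
  obtain ⟨u, v, huv⟩ := hc
  have : b * (a ^ 3 + b ^ 3) = (a ^ 3 + b ^ 3) * u * (b * (p ^ 3 + q ^ 3)) +
      b * v * ((a ^ 3 + b ^ 3) * q ^ 5) := by linear_combination (-b * (a ^ 3 + b ^ 3)) * huv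
  rw [this]
  exact dvd_add (hD.mul_left _) (hq.mul_left _)

lemma cube_add_cube_ne_zero {R : Type*} [CommRing R] [LinearOrder R] [IsStrictOrderedRing R]
    {a b : R} (h : a + b ≠ 0) : a ^ 3 + b ^ 3 ≠ 0 := by
  intro h0
  have : (a + b) * (a ^ 2 - a * b + b ^ 2) = 0 := by linear_combination h0
  rcases mul_eq_zero.mp this with h1 | h1
  · exact h h1
  · have ha : a = 0 := by nlinarith [sq_nonneg (a - b), sq_nonneg (a + b), sq_nonneg a, sq_nonneg b]
    have hb : b = 0 := by nlinarith [sq_nonneg (a - b), sq_nonneg (a + b), sq_nonneg a, sq_nonneg b]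
    exact h (by simp [ha, hb])

/-- `4(p^2 - pq + q^2) = 3p^2 + (p - 2q)^2`, and symmetrically. -/
lemma three_mul_sq_max_le (p q : ℤ) :
    3 * max |p| |q| ^ 2 ≤ 4 * (p ^ 2 - p * q + q ^ 2) := by
  rcases max_choice |p| |q| with h | h <;> rw [h, sq_abs]
  · nlinarith [sq_nonneg (p - 2 * q)]
  · nlinarith [sq_nonneg (q - 2 * p)]

lemma three_mul_sq_max_mul_le_abs_cube_add_cube (p q : ℤ) :
    3 * max |p| |q| ^ 2 * |p + q| ≤ 4 * |p ^ 3 + q ^ 3| := by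
  have h0 : p ^ 3 + q ^ 3 = (p ^ 2 - p * q + q ^ 2) * (p + q) := by ring
  have h1 := three_mul_sq_max_le p q
  have h2 : 0 ≤ p ^ 2 - p * q + q ^ 2 := by nlinarith [sq_nonneg (max |p| |q|)]
  rw [h0, abs_mul, abs_of_nonneg h2, ← mul_assoc]
  exact mul_le_mul_of_nonneg_right h1 (abs_nonneg _)

/-- The coordinates of `φ_t(x)`, for `t = [a : b]` and `x = [p : q]`, are not both small. -/
lemma abs_mul_cube_le_max {a b p q T S : ℤ} (hab : a + b ≠ 0) (hbT : |b| ≤ T)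
    (hS : S = max |p| |q|) :
    |b| * S ^ 3 ≤ 16 * T * max |q ^ 2 * (b * p - a * q)| |b * (p ^ 3 + q ^ 3)| := by
  have hS0 : 0 ≤ S := hS ▸ le_max_of_le_left (abs_nonneg _)
  have hpS : |p| ≤ S := hS ▸ le_max_left _ _
  have hqS : |q| ≤ S := hS ▸ le_max_right _ _
  have hb0 := abs_nonneg b
  have hT0 : 0 ≤ T := hb0.trans hbT
  set M := max |q ^ 2 * (b * p - a * q)| |b * (p ^ 3 + q ^ 3)| with hM
  have hMN : |q ^ 2 * (b * p - a * q)| ≤ M := le_max_left _ _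
  have hMD : |b * (p ^ 3 + q ^ 3)| ≤ M := le_max_right _ _
  rw [abs_mul] at hMN hMD
  have hcube := three_mul_sq_max_mul_le_abs_cube_add_cube p q
  rw [← hS] at hcube
  -- if `x` is not close to `-1`, the denominator is large
  by_cases hfar : S ≤ 4 * T * |p + q|
  · have h1 : |b| * S ^ 3 ≤ |b| * (S ^ 2 * (4 * T * |p + q|)) := by
      have : S ^ 3 = S ^ 2 * S := by ring
      rw [this]
      gcongr
    have h2 : |b| * (S ^ 2 * (4 * T * |p + q|)) * 3 ≤ 16 * T * (|b| * |p ^ 3 + q ^ 3|) := by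
      calc _ = 4 * T * |b| * (3 * S ^ 2 * |p + q|) := by ring
        _ ≤ 4 * T * |b| * (4 * |p ^ 3 + q ^ 3|) := by gcongr
        _ = _ := by ring
    have h3 : 16 * T * (|b| * |p ^ 3 + q ^ 3|) ≤ 16 * T * M := by gcongr
    have h4 : 0 ≤ |b| * S ^ 3 := by positivity
    linarith
  -- Now `x` is close to `-1`: `|q|` is comparable to `S`, and `bp - aq = b(p + q) - (a + b)q` is
  -- dominated by its second term, where `|a + b| ≥ 1`. So the numerator is large.
  · rw [not_le] at hfar
    rcases hb0.eq_or_lt with hb | hb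
    · rw [← hb]
      have : 0 ≤ M := le_max_of_le_left (abs_nonneg _)
      simpa using mul_nonneg (by positivity) this
    have hT1 : 1 ≤ T := by linarith [Int.add_one_le_iff.mpr hb]
    have hpq4 : 4 * |p + q| ≤ S := by nlinarith [abs_nonneg (p + q)]
    have hq : S ≤ 2 * |q| := by
      rcases max_choice |p| |q| with h | h <;> rw [h] at hS
      · have : |p| ≤ |p + q| + |q| := by
          calc |p| = |(p + q) - q| := by ring_nf
            _ ≤ _ := abs_sub _ _
        linarith
      · linarith
    have hlin : S ≤ 4 * |b * p - a * q| := by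
      have h1 : |q| ≤ |b * (p + q)| + |b * p - a * q| := by
        calc |q| = 1 * |q| := (one_mul _).symm
          _ ≤ |a + b| * |q| := by gcongr; exact Int.one_le_abs hab
          _ = |b * (p + q) - (b * p - a * q)| := by rw [← abs_mul]; congr 1; ring
          _ ≤ _ := abs_sub _ _
      have h2 : 4 * |b * (p + q)| ≤ S := by
        rw [abs_mul]
        nlinarith [abs_nonneg (p + q)]
      linarith
    have h5 : S ^ 3 ≤ 16 * M := by
      calc S ^ 3 = S * S * S := by ring
        _ ≤ (2 * |q|) * (2 * |q|) * (4 * |b * p - a * q|) := by gcongr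
        _ = 16 * (|q ^ 2| * |b * p - a * q|) := by rw [abs_pow]; ring
        _ ≤ 16 * M := by gcongr
    calc |b| * S ^ 3 ≤ T * (16 * M) := by gcongr
      _ = _ := by ring

/-- The height on the line grows like a cube under `φ_t`, up to a factor polynomial in the height
of the parameter. -/
lemma expHeight_pow_le_cubicMap {t : ℚ} (ht : t ≠ -1) (P : OnePoint ℚ) :
    expHeight P ^ 3 ≤ 32 * Height.mulHeight₁ t ^ 4 * expHeight (cubicMap t P) := by
  obtain ⟨p, q, hpq, rfl, hP⟩ := exists_eq_ratio_intCast P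
  set a : ℤ := t.num with ha
  set b : ℤ := (t.den : ℤ) with hb
  have hb0 : 0 < b := by simp [hb, t.den_pos]
  have htab : t = (a / b : ℚ) := by simp [ha, hb, Rat.num_div_den]
  have hab : a + b ≠ 0 := by
    intro h
    apply ht
    have : (b : ℚ) ≠ 0 := by exact_mod_cast hb0.ne'
    rw [htab, eq_neg_of_add_eq_zero_left h]
    push_cast
    field_simp
  have hpq0 : p ≠ 0 ∨ q ≠ 0 := by
    by_contra! h
    rw [h.1, h.2] at hpq
    exact not_isCoprime_zero_zero hpq
  set T : ℤ := max |a| |b| with hT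
  have hTt : Height.mulHeight₁ t = T := by
    rw [Rat.mulHeight₁_eq_max, hT, abs_of_pos hb0]
    simp [hb, ha]
  have hs : a ^ 3 + b ^ 3 ≠ 0 := cube_add_cube_ne_zero hab
  have hT0 : 0 < T := lt_max_of_lt_right (abs_pos.mpr hb0.ne')
  rw [hP, hTt]
  conv_rhs => rw [htab, cubicMap_ratio a b p q hb0.ne' hpq0]
  set S : ℤ := max |p| |q| with hS
  set N : ℤ := q ^ 2 * (b * p - a * q) with hN
  set D : ℤ := b * (p ^ 3 + q ^ 3) with hD
  have hmax := abs_mul_cube_le_max hab (le_max_right |a| |b|) hS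
  rw [← hT, ← hN, ← hD] at hmax
  have hS1 : 0 < S := by
    rcases hpq0 with h | h
    · exact lt_max_of_lt_left (abs_pos.mpr h)
    · exact lt_max_of_lt_right (abs_pos.mpr h)
  have hND : N ≠ 0 ∨ D ≠ 0 := by
    by_contra! h
    rw [h.1, h.2] at hmax
    have : 0 < |b| * S ^ 3 := by positivity
    simp at hmax
    linarith
  have hg : (Int.gcd N D : ℤ) ≤ |b| * (2 * T ^ 3) := by
    have h1 := Int.le_of_dvd (abs_pos.mpr (mul_ne_zero hb0.ne' hs))
      ((dvd_abs _ _).mpr (gcd_cubic_dvd (a := a) (b := b) hpq))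
    refine h1.trans ?_
    rw [abs_mul]
    gcongr
    calc |a ^ 3 + b ^ 3| ≤ |a ^ 3| + |b ^ 3| := abs_add_le _ _
      _ = |a| ^ 3 + |b| ^ 3 := by rw [abs_pow, abs_pow]
      _ ≤ T ^ 3 + T ^ 3 := by gcongr <;> simp [hT]
      _ = _ := by ring
  have hle := max_abs_le_mul_expHeight_ratio hND hg
  set h := expHeight (ratio N D)
  have hmaxR : (|b| : ℝ) * (S : ℝ) ^ 3 ≤ 16 * T * ((max |N| |D| : ℤ) : ℝ) := by exact_mod_cast hmax
  have hbR : (0 : ℝ) < |(b : ℝ)| := by exact_mod_cast abs_pos.mpr hb0.ne'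
  have hTR : (0 : ℝ) < T := by exact_mod_cast hT0
  -- The factor `|b|` of the gcd bound cancels the one in `hmax`, leaving `16 T * 2 T^3 = 32 T^4`.
  refine le_of_mul_le_mul_left (a := |(b : ℝ)|) ?_ hbR
  calc (|b| : ℝ) * (S : ℝ) ^ 3 ≤ 16 * T * ((max |N| |D| : ℤ) : ℝ) := hmaxR
    _ ≤ 16 * T * (((|b| * (2 * T ^ 3) : ℤ) : ℝ) * h) := by gcongr
    _ = _ := by push_cast; ring

/-- A point of large height compared with the parameter is not mapped to an integer. -/
lemma cubicMap_notMem_integers {t : ℚ} {P : OnePoint ℚ}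
    (hP : 6 * Height.mulHeight₁ t ^ 2 ≤ expHeight P) : cubicMap t P ∉ integers := by
  obtain ⟨p, q, hpq, rfl, hS⟩ := exists_eq_ratio_intCast P
  set a : ℤ := t.num with ha
  set b : ℤ := (t.den : ℤ) with hb
  have hb0 : 0 < b := by simp [hb, t.den_pos]
  have htab : t = (a / b : ℚ) := by simp [ha, hb, Rat.num_div_den]
  have hpq0 : p ≠ 0 ∨ q ≠ 0 := by
    by_contra! h
    rw [h.1, h.2] at hpq
    exact not_isCoprime_zero_zero hpq
  set T : ℤ := max |a| |b| with hT
  have hTt : Height.mulHeight₁ t = T := by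
    rw [Rat.mulHeight₁_eq_max, hT, abs_of_pos hb0]
    simp [hb, ha]
  have hT0 : 0 < T := lt_max_of_lt_right (abs_pos.mpr hb0.ne')
  set S : ℤ := max |p| |q| with hSdef
  have hTS : 6 * T ^ 2 ≤ S := by rw [hTt, hS] at hP; exact_mod_cast hP
  rw [htab, cubicMap_ratio a b p q hb0.ne' hpq0]
  rintro ⟨n, hn⟩
  have hD : b * (p ^ 3 + q ^ 3) ≠ 0 := by
    intro h
    simp [ratio, h] at hn
  have heq : q ^ 2 * (b * p - a * q) = n * (b * (p ^ 3 + q ^ 3)) := by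
    have hD' : ((b * (p ^ 3 + q ^ 3) : ℤ) : ℚ) ≠ 0 := by exact_mod_cast hD
    simp only [ratio, if_neg hD', OnePoint.coe_eq_coe] at hn
    rw [eq_div_iff hD'] at hn
    exact_mod_cast hn.symm
  have hc : IsCoprime (p ^ 3 + q ^ 3) (q ^ 2) := (isCoprime_cube_add_cube hpq).pow_right
  have hdvd : p ^ 3 + q ^ 3 ∣ b * p - a * q :=
    hc.dvd_of_dvd_mul_left ⟨n * b, by rw [heq]; ring⟩
  have hs : p ^ 3 + q ^ 3 ≠ 0 := right_ne_zero_of_mul hD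
  have hS0 : 0 < S := by nlinarith
  -- If `bp = aq`, then `P = t` has height only `T`. Otherwise the roughly quadratic lower bound for
  -- `|p^3 + q^3|` meets the upper bound `2 T S` for its nonzero multiple.
  by_cases h0 : b * p - a * q = 0
  · have hcab : IsCoprime a b := by simpa [ha, hb] using Rat.isCoprime_num_den t
    have h1 : p ∣ a := hpq.dvd_of_dvd_mul_right ⟨b, by linear_combination -h0⟩
    have h2 : q ∣ b := hpq.symm.dvd_of_dvd_mul_right ⟨a, by linear_combination h0⟩
    have h3 : |q| ≤ T := (Int.le_of_dvd (abs_pos.mpr hb0.ne') ((abs_dvd_abs _ _).mpr h2)).trans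
      (le_max_right _ _)
    have h4 : a ∣ p := hcab.dvd_of_dvd_mul_left ⟨q, by linear_combination h0⟩
    have h5 : |p| ≤ T := by
      have : |p| = |a| := abs_eq_abs.mpr (Int.associated_iff.mp (associated_of_dvd_dvd h1 h4))
      rw [this]
      exact le_max_left _ _
    have : S ≤ T := max_le h5 h3
    nlinarith
  · have h1 : |p ^ 3 + q ^ 3| ≤ |b * p - a * q| :=
      Int.le_of_dvd (abs_pos.mpr h0) ((abs_dvd_abs _ _).mpr hdvd)
    have h2 : |b * p - a * q| ≤ 2 * T * S := by
      calc |b * p - a * q| ≤ |b * p| + |a * q| := abs_sub _ _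
        _ = |b| * |p| + |a| * |q| := by rw [abs_mul, abs_mul]
        _ ≤ T * S + T * S := by gcongr <;> simp [hT, hSdef]
        _ = _ := by ring
    have h3 := three_mul_sq_max_mul_le_abs_cube_add_cube p q
    have h4 : 1 ≤ |p + q| := by
      refine Int.one_le_abs fun h ↦ hs ?_
      linear_combination (p ^ 2 - p * q + q ^ 2) * h
    have h5 : 3 * S ^ 2 ≤ 4 * (2 * T * S) := by
      calc 3 * S ^ 2 = 3 * S ^ 2 * 1 := (mul_one _).symm
        _ ≤ 3 * S ^ 2 * |p + q| := by gcongr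
        _ ≤ 4 * |p ^ 3 + q ^ 3| := h3
        _ ≤ _ := by linarith
    have h6 : 3 * S ≤ 8 * T := by
      refine le_of_mul_le_mul_right (a := S) ?_ hS0
      linarith
    nlinarith

/-! ### Integers in orbits -/

lemma le_expHeight_cubicMap {t : ℚ} (ht : t ≠ -1) {P : OnePoint ℚ}
    (hP : 6 * Height.mulHeight₁ t ^ 2 ≤ expHeight P) :
    6 * Height.mulHeight₁ t ^ 2 ≤ expHeight (cubicMap t P) := by
  have h := expHeight_pow_le_cubicMap ht P
  have hT := Height.mulHeight₁_pos t
  set T := Height.mulHeight₁ t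
  -- The constant `6` suffices because `6^3 = 216 ≥ 192 = 32 * 6`.
  have h1 : (6 * T ^ 2) ^ 3 ≤ expHeight P ^ 3 := by gcongr
  refine le_of_mul_le_mul_left (a := 32 * T ^ 4) ?_ (by positivity)
  nlinarith [pow_pos hT 6]

lemma le_expHeight_iterate_cubicMap {t : ℚ} (ht : t ≠ -1) {P : OnePoint ℚ}
    (hP : 6 * Height.mulHeight₁ t ^ 2 ≤ expHeight P) (n : ℕ) :
    6 * Height.mulHeight₁ t ^ 2 ≤ expHeight ((cubicMap t)^[n] P) := by
  induction n with
  | zero => exact hP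
  | succ n ih => rw [Function.iterate_succ_apply']; exact le_expHeight_cubicMap ht ih

lemma iterate_cubicMap_notMem_integers {t : ℚ} (ht : t ≠ -1) {P : OnePoint ℚ}
    (hP : 6 * Height.mulHeight₁ t ^ 2 ≤ expHeight P) (n : ℕ) :
    (cubicMap t)^[n + 1] P ∉ integers := by
  rw [Function.iterate_succ_apply']
  exact cubicMap_notMem_integers (le_expHeight_iterate_cubicMap ht hP n)

lemma orbit_inter_integers_subset {t : ℚ} (ht : t ≠ -1) {P : OnePoint ℚ}
    (hP : 6 * Height.mulHeight₁ t ^ 2 ≤ expHeight P) :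
    orbit (cubicMap t) P ∩ integers ⊆ {P} ∩ integers := by
  rintro _ ⟨⟨n, rfl⟩, hn⟩
  cases n with
  | zero => exact ⟨rfl, hn⟩
  | succ n => exact absurd hn (iterate_cubicMap_notMem_integers ht hP n)

/-- Every orbit of `φ_t` contains finitely many integers. -/
lemma finite_orbit_inter_integers {t : ℚ} (ht : t ≠ -1) (P : OnePoint ℚ) :
    (orbit (cubicMap t) P ∩ integers).Finite := by
  -- Either the orbit reaches the threshold and has no integers after that time, or its height stays
  -- bounded and Northcott applies.
  by_cases h : ∃ n, 6 * Height.mulHeight₁ t ^ 2 ≤ expHeight ((cubicMap t)^[n] P)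
  · obtain ⟨n, hn⟩ := h
    refine ((Set.finite_Iic n).image fun k ↦ (cubicMap t)^[k] P).subset ?_
    rintro _ ⟨⟨k, rfl⟩, hk⟩
    refine ⟨k, ?_, rfl⟩
    by_contra hkn
    obtain ⟨m, rfl⟩ : ∃ m, k = m + 1 + n := ⟨k - n - 1, by simp at hkn; omega⟩
    simp only [Function.iterate_add_apply _ (m + 1) n] at hk
    exact iterate_cubicMap_notMem_integers ht hn m hk
  · push Not at h
    refine (finite_setOf_expHeight_le (6 * Height.mulHeight₁ t ^ 2)).subset ?_
    rintro _ ⟨⟨k, rfl⟩, -⟩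
    exact (h k).le

/-! ### The good parameters -/

lemma natDegree_X_pow_three_add_one {K : Type*} [Field K] : (X ^ 3 + 1 : K[X]).natDegree = 3 := by
  rw [← C_1]; exact natDegree_X_pow_add_C

lemma isRat_cubic_iff {K : Type*} [Field K] (t : K) :
    IsRat 3 (X - C t : K[X]) (X ^ 3 + 1) ↔ t ^ 3 + 1 ≠ 0 := by
  have hc : (1 : K[X]).coeff 3 = 0 := by simp [coeff_one]
  -- The formal degree is split as `1 + 2`: the two excess degrees contribute only powers of the
  -- leading coefficient `1`, up to a sign which is `+`.
  have h : resultant (X - C t) (X ^ 3 + 1 : K[X]) (1 + 2) 3 = t ^ 3 + 1 := by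
    rw [resultant_add_left_deg _ _ _ _ _ (natDegree_X_sub_C_le t),
      resultant_X_sub_C_left _ _ _ natDegree_X_pow_three_add_one.le]
    simp [hc]
    norm_num
  simp [IsRat, natDegree_X_pow_three_add_one, h]

/-- For `t ≠ -1` the second iterate of `φ_t` is not a polynomial. -/
lemma secondIterate_cubic_notMem_range {K : Type*} [Field K] {t : K} (ht : t ≠ -1) :
    secondIterate (X - C t : K[X]) (X ^ 3 + 1) ∉
      Set.range (algebraMap (AlgebraicClosure K)[X] (RatFunc (AlgebraicClosure K))) := by
  set L := AlgebraicClosure K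
  set s : L := algebraMap K L t with hs
  have hs1 : s + 1 ≠ 0 := by
    intro h
    apply ht
    apply (algebraMap K L).injective
    rw [map_neg, map_one, ← hs]
    exact eq_neg_of_add_eq_zero_left h
  rintro ⟨P, hP⟩
  -- `N / D` is the second iterate. As `deg N ≤ 9 = deg D`, a polynomial quotient would be a nonzero
  -- constant, but `N` vanishes at `-1` and `D` does not.
  let N : L[X] := (X ^ 3 + 1) ^ 2 * (X - C s - C s * (X ^ 3 + 1))
  let D : L[X] := (X - C s) ^ 3 + (X ^ 3 + 1) ^ 3
  have h3 : (X ^ 3 + 1 : L[X]).natDegree = 3 := natDegree_X_pow_three_add_one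
  have hQ : (X ^ 3 + 1 : L[X]) ≠ 0 := fun h ↦ by simp [h] at h3
  have hDdeg : D.natDegree = 9 := by
    have h1 : ((X ^ 3 + 1 : L[X]) ^ 3).natDegree = 9 := by rw [natDegree_pow, h3]
    have h2 : ((X - C s : L[X]) ^ 3).natDegree = 3 := by rw [natDegree_pow, natDegree_X_sub_C]
    rw [natDegree_add_eq_right_of_natDegree_lt (by rw [h1, h2]; norm_num), h1]
  have hD0 : D ≠ 0 := fun h ↦ by simp [h] at hDdeg
  have hNdeg : N.natDegree ≤ 9 := by
    refine natDegree_mul_le.trans ?_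
    have h1 : ((X ^ 3 + 1 : L[X]) ^ 2).natDegree = 6 := by rw [natDegree_pow, h3]
    have h2 : (X - C s - C s * (X ^ 3 + 1) : L[X]).natDegree ≤ 3 := by
      refine (natDegree_sub_le _ _).trans (max_le ((natDegree_X_sub_C_le s).trans (by norm_num)) ?_)
      exact (natDegree_C_mul_le _ _).trans h3.le
    omega
  have hN0 : N ≠ 0 := by
    refine mul_ne_zero (pow_ne_zero 2 hQ) fun h ↦ ?_
    have hc : (1 : L[X]).coeff 1 = 0 := by simp [coeff_one]
    have := congr(coeff $h 1)
    simp [hc] at this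
  have hPD : P * D = N := by
    apply RatFunc.algebraMap_injective L
    have hX : algebraMap L[X] (RatFunc L) (X ^ 3 + 1) ≠ 0 := RatFunc.algebraMap_ne_zero hQ
    have hD : algebraMap L[X] (RatFunc L) D ≠ 0 := RatFunc.algebraMap_ne_zero hD0
    rw [map_mul, hP]
    simp only [D, N, secondIterate, map_add, map_sub, map_mul, map_pow, map_one,
      RatFunc.algebraMap_X, RatFunc.algebraMap_C, eval₂_sub, eval₂_add, eval₂_X, eval₂_C,
      eval₂_pow, eval₂_one, RingHom.comp_apply] at hX hD ⊢
    rw [← hs]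
    field_simp
  have hNd : N.eval (-1) = 0 := by
    have : ((-1 : L) ^ 3 + 1) = 0 := by ring
    simp [N, this]
  have hDd : D.eval (-1) ≠ 0 := by
    have h1 : ((-1 : L) ^ 3 + 1) = 0 := by ring
    have h2 : (-1 : L) - s = -(s + 1) := by ring
    simp only [D, eval_add, eval_pow, eval_sub, eval_X, eval_C, eval_one, h1, h2]
    simpa using neg_ne_zero.mpr hs1
  have hP0 : P ≠ 0 := fun h ↦ hN0 (by rw [← hPD, h, zero_mul])
  have hPdeg : P.natDegree = 0 := by
    have := natDegree_mul hP0 hD0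
    rw [hPD] at this
    omega
  obtain ⟨r, rfl⟩ := natDegree_eq_zero.mp hPdeg
  have hr : r ≠ 0 := fun h ↦ hP0 (by rw [h, C_0])
  have := congr(eval (-1) $hPD)
  rw [hNd, eval_mul, eval_C] at this
  exact mul_ne_zero hr hDd this

theorem goodParams_cubicFamily : goodParams 3 cubicFamily = {((-1 : ℚ) : OnePoint ℚ), ∞}ᶜ := by
  ext P
  induction P using OnePoint.rec with
  | infty =>
    simp [goodParams, cubicFamily, IsRat]
  | coe t =>
    have h : t ^ 3 + 1 ≠ 0 ↔ t ≠ -1 := by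
      refine not_congr ⟨fun h ↦ ?_, fun h ↦ by rw [h]; norm_num⟩
      have : (t + 1) * ((t - 1 / 2) ^ 2 + 3 / 4) = 0 := by linear_combination h
      rcases mul_eq_zero.mp this with h1 | h1
      · exact eq_neg_of_add_eq_zero_left h1
      · nlinarith [sq_nonneg (t - 1 / 2)]
    simp only [goodParams, cubicFamily, Set.mem_ofPred_eq, isRat_cubic_iff, h, Set.mem_compl_iff,
      Set.mem_insert_iff, Set.mem_singleton_iff, OnePoint.coe_eq_coe, OnePoint.coe_ne_infty,
      or_false]
    exact ⟨fun H ↦ H.1, fun H ↦ ⟨H, secondIterate_cubic_notMem_range H⟩⟩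

/-! ### Parameters at which `β` is integral -/

lemma exists_den_pow_mul_abs_eval_le (F : ℚ[X]) {d : ℕ} (hF : F.natDegree ≤ d) :
    ∃ C : ℝ, ∀ t : ℚ, ((t.den : ℚ) ^ d * |F.eval t| : ℚ) ≤ C * Height.mulHeight₁ t ^ d := by
  refine ⟨((∑ i ∈ Finset.range (d + 1), |F.coeff i| : ℚ) : ℝ), fun t ↦ ?_⟩
  have hden : (0 : ℚ) < t.den := by exact_mod_cast t.den_pos
  have hH : Height.mulHeight₁ t = ((t.den * max 1 |t| : ℚ) : ℝ) := by
    rw [Rat.mulHeight₁_eq_max, mul_max_of_nonneg _ _ hden.le]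
    have : (t.den : ℚ) * |t| = t.num.natAbs := by
      rw [← abs_of_pos hden, ← abs_mul, Rat.den_mul_eq_num]
      simp
    rw [this, mul_one, max_comm]
    push_cast
    rfl
  rw [hH]
  rw [← Rat.cast_pow, ← Rat.cast_mul, Rat.cast_le, mul_pow, mul_left_comm]
  gcongr
  rw [eval_eq_sum_range' (Nat.lt_succ_of_le hF), Finset.sum_mul]
  refine (Finset.abs_sum_le_sum_abs _ _).trans (Finset.sum_le_sum fun i hi ↦ ?_)
  rw [abs_mul, abs_pow]
  gcongr
  calc |t| ^ i ≤ max 1 |t| ^ i := by gcongr; exact le_max_right _ _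
    _ ≤ max 1 |t| ^ d := pow_le_pow_right₀ (le_max_left _ _) (Finset.mem_range_succ_iff.mp hi)

lemma exists_mul_den_pow_mul_eval_eq_intCast (G : ℚ[X]) {d : ℕ} (hG : G.natDegree ≤ d) :
    ∃ N : ℤ, N ≠ 0 ∧ ∀ t : ℚ, ∃ m : ℤ, (N : ℚ) * ((t.den : ℚ) ^ d * G.eval t) = m := by
  obtain ⟨N, hNmem, hN⟩ := IsLocalization.integerNormalization_spec (nonZeroDivisors ℤ) G
  set G' := IsLocalization.integerNormalization (nonZeroDivisors ℤ) G with hG'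
  have hN0 : N ≠ 0 := nonZeroDivisors.ne_zero hNmem
  have hdeg : G'.natDegree ≤ d := by
    rw [← natDegree_map_eq_of_injective (algebraMap ℤ ℚ).injective_int G', hN]
    exact (natDegree_smul_le _ _).trans hG
  refine ⟨N, hN0, fun t ↦ ?_⟩
  have hden : (t.den : ℚ) ≠ 0 := by exact_mod_cast t.den_nz
  obtain ⟨D, e, he, hD⟩ := denomsClearable_of_natDegree_le (i := algebraMap ℤ ℚ) d t.num
    (b := (t.den : ℤ)) (bi := (t.den : ℚ)⁻¹) (by simp [hden]) G' hdeg
  refine ⟨D, ?_⟩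
  have he' : e = (t.den : ℚ)⁻¹ := eq_inv_of_mul_eq_one_left (by simpa using he)
  rw [hN, he'] at hD
  simp only [eq_intCast, Int.cast_natCast, ← div_eq_mul_inv, Rat.num_div_den] at hD
  rw [hD]
  simp
  ring

/-- At a point where `β` is integral, the denominator of `β` is bounded. -/
lemma exists_bound_of_value_mem_integers (β : RatFunc ℚ) :
    ∃ N M : ℤ, N ≠ 0 ∧ ∀ t : ℚ, value β (t : OnePoint ℚ) ∈ integers →
      ∃ m : ℤ, m ≠ 0 ∧ |m| ≤ M ∧
        (N : ℚ) * ((t.den : ℚ) ^ degree β * β.denom.eval t) = m := by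
  obtain ⟨c, hc, hlow⟩ := exists_mulHeight_eval_ge β.isCoprime_num_denom
  obtain ⟨C₁, hC₁⟩ := exists_den_pow_mul_abs_eval_le β.num (d := degree β) (le_max_left _ _)
  obtain ⟨C₂, hC₂⟩ := exists_den_pow_mul_abs_eval_le β.denom (d := degree β) (le_max_right _ _)
  obtain ⟨N, hN, hint⟩ := exists_mul_den_pow_mul_eval_eq_intCast β.denom (d := degree β)
    (le_max_right _ _)
  refine ⟨N, ⌊|(N : ℝ)| * (max C₁ C₂ / c)⌋, hN, fun t ⟨n, hn⟩ ↦ ?_⟩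
  obtain ⟨m, hm⟩ := hint t
  have hval := expHeight_value_coe β t
  rw [← hn, expHeight_coe, Rat.mulHeight₁_eq_max] at hval
  replace hlow := hlow t
  rw [← hval] at hlow
  rw [value_coe] at hn
  have hG : β.denom.eval t ≠ 0 := by
    intro h
    simp [ratio, h] at hn
  have hF : β.num.eval t = n * β.denom.eval t := by
    simp only [ratio, if_neg hG, OnePoint.coe_eq_coe] at hn
    rw [hn, div_mul_cancel₀ _ hG]
  have hden : (t.den : ℚ) ≠ 0 := by exact_mod_cast t.den_nz
  refine ⟨m, ?_, ?_, hm⟩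
  · rintro rfl
    simp [hN, hden, hG] at hm
  rw [Int.le_floor]
  -- If `β_t = n`, then `g * max(|n|, 1)` is at most a constant times `H(t)^d`, while `max(|n|, 1) =
  -- H(β_t) ≥ c H(t)^d`. Dividing bounds `g`.
  set g : ℚ := (t.den : ℚ) ^ degree β * |β.denom.eval t|
  have hH : 0 < Height.mulHeight₁ t ^ degree β := pow_pos (Height.mulHeight₁_pos t) _
  have hg0 : (0 : ℝ) ≤ g := by exact_mod_cast (by positivity : (0 : ℚ) ≤ g)
  have h1 : (g : ℝ) * |(n : ℝ)| ≤ max C₁ C₂ * Height.mulHeight₁ t ^ degree β := by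
    have := hC₁ t
    rw [hF, abs_mul, mul_left_comm] at this
    refine (le_of_eq ?_).trans (this.trans ?_)
    · simp only [g]; push_cast; ring
    · gcongr; exact le_max_left _ _
  have h2 : (g : ℝ) ≤ max C₁ C₂ * Height.mulHeight₁ t ^ degree β :=
    (hC₂ t).trans (by gcongr; exact le_max_right _ _)
  have h3 : (g : ℝ) * ((max (n : ℚ).num.natAbs (n : ℚ).den : ℕ) : ℝ) ≤
      max C₁ C₂ * Height.mulHeight₁ t ^ degree β := by
    rcases max_choice (n : ℚ).num.natAbs (n : ℚ).den with h | h <;> rw [h]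
    · simpa using h1
    · simpa using h2
  have h4 : (g : ℝ) ≤ max C₁ C₂ / c := by
    rw [le_div_iff₀ hc]
    refine le_of_mul_le_mul_right (le_trans ?_ h3) hH
    rw [mul_assoc]
    gcongr
    exact_mod_cast hlow
  have h5 : (|m| : ℚ) = |(N : ℚ)| * g := by
    rw [← hm, abs_mul, abs_mul, abs_pow, Nat.abs_cast]
  have h6 : ((|m| : ℤ) : ℝ) = |(N : ℝ)| * g := by exact_mod_cast congr(((($h5) : ℚ) : ℝ))
  rw [h6]
  gcongr

/-- The points of the line at which `β` is integral are sparse. -/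
lemma exists_ncard_value_mem_integers_le {β : RatFunc ℚ} (hβ : 1 ≤ degree β) :
    ∃ A : ℕ, ∀ n : ℕ, 1 ≤ n →
      {t : ℚ | Height.mulHeight₁ t ≤ n ∧ value β (t : OnePoint ℚ) ∈ integers}.ncard ≤ A * n := by
  classical
  obtain ⟨N, M, hN, H⟩ := exists_bound_of_value_mem_integers β
  have hN' : (N : ℚ) ≠ 0 := by exact_mod_cast hN
  have hpoint (t : ℚ) (n : ℕ) (ht : Height.mulHeight₁ t ≤ n) : t.num.natAbs ≤ n ∧ t.den ≤ n := by
    rw [Rat.mulHeight₁_eq_max] at ht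
    exact max_le_iff.mp (by exact_mod_cast ht)
  -- For constant denominator of `β`, the relation `m = N * t.den^d` bounds `t.den`, leaving `O(n)`
  -- numerators.
  by_cases hdeg : β.denom.natDegree = 0
  · have hone : β.denom = 1 := (RatFunc.monic_denom β).natDegree_eq_zero.mp hdeg
    refine ⟨3 * (M.toNat + 1), fun n hn ↦ ?_⟩
    let s : Finset ℚ := ((Finset.Icc (-n : ℤ) n) ×ˢ Finset.range (M.toNat + 1)).image
      fun x ↦ (x.1 : ℚ) / (x.2 : ℚ)
    have hs : {t : ℚ | Height.mulHeight₁ t ≤ n ∧ value β (t : OnePoint ℚ) ∈ integers} ⊆ s := by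
      rintro t ⟨ht, hint⟩
      obtain ⟨m, hm0, hmM, hm⟩ := H t hint
      simp only [s, Finset.coe_image, Set.mem_image, Finset.mem_coe, Finset.mem_product,
        Finset.mem_Icc, Finset.mem_range]
      refine ⟨(t.num, t.den), ⟨?_, ?_⟩, by simp [Rat.num_div_den]⟩
      · have := (hpoint t n ht).1
        constructor <;> simp only <;> omega
      · rw [hone, eval_one, mul_one] at hm
        have hm' : N * (t.den : ℤ) ^ degree β = m := by exact_mod_cast hm
        have h1 : (t.den : ℤ) ≤ |m| := by
          rw [← hm', abs_mul, abs_pow, Nat.abs_cast]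
          have h2 : (t.den : ℤ) ≤ (t.den : ℤ) ^ degree β := by
            exact_mod_cast Nat.le_self_pow (by omega) t.den
          have h3 : 1 ≤ |N| := Int.one_le_abs hN
          nlinarith
        simp only
        omega
    calc _ ≤ (s : Set ℚ).ncard := Set.ncard_le_ncard hs s.finite_toSet
      _ = s.card := Set.ncard_coe_finset s
      _ ≤ _ := Finset.card_image_le
      _ = (2 * n + 1) * (M.toNat + 1) := by
        rw [Finset.card_product, Int.card_Icc, Finset.card_range]
        congr 1
        omega
      _ ≤ (3 * n) * (M.toNat + 1) := by gcongr; omega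
      _ = _ := by ring
  -- Here `t.den` and `m` determine `t` up to the roots of a nonconstant polynomial of degree at
  -- most `degree β`, and there are at most `n (2M + 1)` such pairs.
  · refine ⟨(2 * M + 1).toNat * degree β, fun n hn ↦ ?_⟩
    let Q : ℕ × ℤ → ℚ[X] := fun x ↦ C ((N : ℚ) * (x.1 : ℚ) ^ degree β) * β.denom - C (x.2 : ℚ)
    let s : Finset ℚ := ((Finset.Icc 1 n) ×ˢ Finset.Icc (-M) M).biUnion
      fun x ↦ (Q x).roots.toFinset
    have hs : {t : ℚ | Height.mulHeight₁ t ≤ n ∧ value β (t : OnePoint ℚ) ∈ integers} ⊆ s := by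
      rintro t ⟨ht, hint⟩
      obtain ⟨m, hm0, hmM, hm⟩ := H t hint
      have hden : (t.den : ℚ) ≠ 0 := by exact_mod_cast t.den_nz
      simp only [s, Finset.coe_biUnion, Set.mem_iUnion, Finset.mem_coe, Finset.mem_product,
        Finset.mem_Icc, Multiset.mem_toFinset]
      refine ⟨(t.den, m), ⟨⟨t.den_pos, (hpoint t n ht).2⟩, abs_le.mp hmM⟩, ?_⟩
      rw [mem_roots']
      constructor
      · intro h0
        have h1 : (Q (t.den, m)).natDegree = β.denom.natDegree := by
          simp only [Q]
          rw [natDegree_sub_C, natDegree_C_mul (mul_ne_zero hN' (pow_ne_zero _ hden))]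
        rw [h0, natDegree_zero] at h1
        exact hdeg h1.symm
      · simp only [Q, IsRoot, eval_sub, eval_mul, eval_C]
        rw [mul_assoc, hm, sub_self]
    calc _ ≤ (s : Set ℚ).ncard := Set.ncard_le_ncard hs s.finite_toSet
      _ = s.card := Set.ncard_coe_finset s
      _ ≤ _ := Finset.card_biUnion_le_card_mul _ _ (degree β) fun x _ ↦ by
        refine (Multiset.toFinset_card_le _).trans ((card_roots' _).trans ?_)
        simp only [Q]
        rw [natDegree_sub_C]
        exact (natDegree_C_mul_le _ _).trans (le_max_right _ _)
      _ = (n * (2 * M + 1).toNat) * degree β := by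
        rw [Finset.card_product, Int.card_Icc, Nat.card_Icc]
        congr 2
        congr 1
        ring
      _ = _ := by ring

/-! ### Counting parameters by height -/

/-- The number of rational numbers of height at most `n` grows faster than linearly. -/
lemma mul_half_le_ncard_mulHeight_le {k n : ℕ} (hkn : 2 ^ k ≤ n) :
    k * (n / 2) ≤ {t : ℚ | Height.mulHeight₁ t ≤ n ∧ t ≠ -1}.ncard := by
  -- Odd numerators over powers of `2` are automatically reduced, so distinct pairs give distinct
  -- fractions. Each of `k` denominators yields `n / 2` of them.
  let f : ℕ × ℕ → ℚ := fun x ↦ ((2 * x.2 + 1 : ℕ) : ℤ) / ((2 ^ (x.1 + 1) : ℕ) : ℤ)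
  have hcop (x : ℕ × ℕ) : Nat.Coprime (2 * x.2 + 1) (2 ^ (x.1 + 1)) :=
    Nat.Coprime.pow_right _ (by simp)
  have hnum (x : ℕ × ℕ) : (f x).num = (2 * x.2 + 1 : ℕ) :=
    Rat.num_div_eq_of_coprime (by positivity) (by simpa only [Int.natAbs_natCast] using hcop x)
  have hden (x : ℕ × ℕ) : (f x).den = 2 ^ (x.1 + 1) := by
    have := Rat.den_div_eq_of_coprime (a := ((2 * x.2 + 1 : ℕ) : ℤ))
      (b := ((2 ^ (x.1 + 1) : ℕ) : ℤ)) (by positivity)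
      (by simpa only [Int.natAbs_natCast] using hcop x)
    exact Nat.cast_injective (R := ℤ) this
  have hinj : Function.Injective f := fun x y hxy ↦ by
    have h1 := congr(Rat.num $hxy)
    have h2 := congr(Rat.den $hxy)
    rw [hnum, hnum] at h1
    rw [hden, hden] at h2
    have h3 := Nat.pow_right_injective le_rfl h2
    ext <;> omega
  let s : Finset (ℕ × ℕ) := Finset.range k ×ˢ Finset.range (n / 2)
  have hs : ((s.map ⟨f, hinj⟩ : Finset ℚ) : Set ℚ) ⊆
      {t : ℚ | Height.mulHeight₁ t ≤ n ∧ t ≠ -1} := by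
    intro t ht
    obtain ⟨x, hx, rfl⟩ := Finset.mem_map.mp ht
    simp only [s, Finset.mem_product, Finset.mem_range] at hx
    refine ⟨?_, fun h ↦ ?_⟩
    · rw [Rat.mulHeight₁_eq_max]
      simp only [Function.Embedding.coeFn_mk]
      rw [hnum, hden, Int.natAbs_natCast]
      have h1 : 2 ^ (x.1 + 1) ≤ n := (Nat.pow_le_pow_right two_pos (by omega)).trans hkn
      exact_mod_cast max_le (by omega) h1
    · simp only [Function.Embedding.coeFn_mk] at h
      have h1 := hnum x
      rw [h] at h1
      simp at h1
      omega
  have hfin : {t : ℚ | Height.mulHeight₁ t ≤ n ∧ t ≠ -1}.Finite :=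
    (NumberField.finite_setOfPred_mulHeight₁_le ℚ n).subset fun t ht ↦ ht.1
  calc k * (n / 2) = (s.map ⟨f, hinj⟩).card := by simp [s]
    _ = ((s.map ⟨f, hinj⟩ : Finset ℚ) : Set ℚ).ncard := (Set.ncard_coe_finset _).symm
    _ ≤ _ := Set.ncard_le_ncard hs hfin

lemma exists_expHeight_value_bounds (β : RatFunc ℚ) :
    ∃ c > 0, ∃ C > 0, ∀ t : ℚ,
      c * Height.mulHeight₁ t ^ degree β ≤ expHeight (value β (t : OnePoint ℚ)) ∧
      expHeight (value β (t : OnePoint ℚ)) ≤ C * Height.mulHeight₁ t ^ degree β := by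
  obtain ⟨c, hc, h₁⟩ := exists_mulHeight_eval_ge β.isCoprime_num_denom
  obtain ⟨C, hC, h₂⟩ := exists_mulHeight_eval_le β.num β.denom
  refine ⟨c, hc, C, hC, fun t ↦ ?_⟩
  rw [expHeight_value_coe]
  exact ⟨h₁ t, h₂ t⟩

lemma mem_goodParams_cubicFamily {P : OnePoint ℚ} :
    P ∈ goodParams 3 cubicFamily ↔ ∃ t : ℚ, t ≠ -1 ∧ (t : OnePoint ℚ) = P := by
  rw [goodParams_cubicFamily]
  induction P using OnePoint.rec with
  | infty => simp
  | coe t => simp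

lemma mulHeight_pow_le_of_mem_goodParamsLE {β : RatFunc ℚ} {c : ℝ} (hc : 0 < c)
    (hlow : ∀ t : ℚ, c * Height.mulHeight₁ t ^ degree β ≤ expHeight (value β (t : OnePoint ℚ)))
    {B : ℝ} {t : ℚ} (ht : (t : OnePoint ℚ) ∈ goodParamsLE 3 cubicFamily β B) :
    Height.mulHeight₁ t ^ degree β ≤ Real.exp B / c := by
  rw [le_div_iff₀' hc]
  exact (hlow t).trans ((height_le_iff _ _).mp ht.2)

theorem finite_goodParamsLE_cubicFamily {β : RatFunc ℚ} (hβ : 1 ≤ degree β) (B : ℝ) :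
    (goodParamsLE 3 cubicFamily β B).Finite := by
  obtain ⟨c, hc, C, -, h⟩ := exists_expHeight_value_bounds β
  refine (finite_setOf_expHeight_le (Real.exp B / c)).subset fun P hP ↦ ?_
  obtain ⟨t, -, rfl⟩ := mem_goodParams_cubicFamily.mp hP.1
  rw [Set.mem_ofPred_eq, expHeight_coe]
  exact (le_self_pow₀ (Height.one_le_mulHeight₁ t) (by omega)).trans
    (mulHeight_pow_le_of_mem_goodParamsLE hc (fun t ↦ (h t).1) hP)

lemma integersInOrbit_cubicFamily_coe (β : RatFunc ℚ) (t : ℚ) :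
    integersInOrbit 3 cubicFamily β (t : OnePoint ℚ) =
      (orbit (cubicMap t) (value β (t : OnePoint ℚ)) ∩ integers).encard := rfl

/-! ### Exceptional parameters and the numerator of the average -/

/-- The parameters `t` for which the height of `β_t` is too small to control the orbit. -/
def exceptionalParams (β : RatFunc ℚ) : Set (OnePoint ℚ) :=
  {P | ∃ t : ℚ, t ≠ -1 ∧ (t : OnePoint ℚ) = P ∧
    expHeight (value β P) < 6 * Height.mulHeight₁ t ^ 2}

/-- `c T^3 ≤ H(β_t) < 6 T^2` forces `T < 6 / c`. This is where `degree β ≥ 3`, rather than just `≥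
1`, is essential to the argument. -/
lemma finite_exceptionalParams {β : RatFunc ℚ} (hβ : 3 ≤ degree β) :
    (exceptionalParams β).Finite := by
  obtain ⟨c, hc, C, -, h⟩ := exists_expHeight_value_bounds β
  refine (finite_setOf_expHeight_le (6 / c)).subset ?_
  rintro _ ⟨t, -, rfl, ht⟩
  rw [Set.mem_ofPred_eq, expHeight_coe, le_div_iff₀' hc]
  have hT := Height.one_le_mulHeight₁ t
  have h1 := (h t).1
  set T := Height.mulHeight₁ t
  have h2 : T ^ 3 ≤ T ^ degree β := pow_le_pow_right₀ hT hβ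
  have h3 : c * T ^ 3 ≤ c * T ^ degree β := by gcongr
  refine le_of_mul_le_mul_right (a := T ^ 2) ?_ (by positivity)
  nlinarith

lemma integersInOrbit_le_one {β : RatFunc ℚ} {P : OnePoint ℚ}
    (hP : P ∈ goodParams 3 cubicFamily) :
    (integersInOrbit 3 cubicFamily β P : ENNReal) ≤
      (exceptionalParams β).indicator
        (fun P ↦ (integersInOrbit 3 cubicFamily β P : ENNReal)) P +
      {P | value β P ∈ integers}.indicator 1 P := by
  obtain ⟨t, ht, rfl⟩ := mem_goodParams_cubicFamily.mp hP
  by_cases hE : (t : OnePoint ℚ) ∈ exceptionalParams β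
  · rw [Set.indicator_of_mem hE]
    exact le_self_add
  · have hbig : 6 * Height.mulHeight₁ t ^ 2 ≤ expHeight (value β (t : OnePoint ℚ)) := by
      by_contra! h
      exact hE ⟨t, ht, rfl, h⟩
    have hsub := orbit_inter_integers_subset ht hbig
    rw [integersInOrbit_cubicFamily_coe, Set.indicator_of_notMem hE, zero_add]
    by_cases hZ : value β (t : OnePoint ℚ) ∈ integers
    · rw [Set.indicator_of_mem (by exact hZ), Pi.one_apply]
      have := (Set.encard_le_encard (hsub.trans Set.inter_subset_left)).trans_eq
        (Set.encard_singleton _)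
      exact_mod_cast this
    · have : orbit (cubicMap t) (value β (t : OnePoint ℚ)) ∩ integers = ∅ := by
        refine Set.subset_empty_iff.mp (hsub.trans ?_)
        rintro x ⟨rfl, hx⟩
        exact hZ hx
      simp [this]

lemma tsum_exceptionalParams_ne_top {β : RatFunc ℚ} (hβ : 3 ≤ degree β) :
    ∑' P, (exceptionalParams β).indicator
      (fun P ↦ (integersInOrbit 3 cubicFamily β P : ENNReal)) P ≠ ⊤ := by
  have := (finite_exceptionalParams hβ).fintype
  rw [← tsum_subtype, tsum_fintype]
  refine ENNReal.sum_ne_top.mpr ?_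
  rintro ⟨_, t, ht, rfl, -⟩ -
  rw [integersInOrbit_cubicFamily_coe]
  simpa using finite_orbit_inter_integers ht _

/-- The first term on the right does not depend on `B`, so only the count of integral `β_P` can
grow. -/
lemma tsum_integersInOrbit_le (β : RatFunc ℚ) (B : ℝ) :
    ∑' P : goodParamsLE 3 cubicFamily β B, (integersInOrbit 3 cubicFamily β P : ENNReal) ≤
      ∑' P, (exceptionalParams β).indicator
        (fun P ↦ (integersInOrbit 3 cubicFamily β P : ENNReal)) P +
      ((goodParamsLE 3 cubicFamily β B ∩ {P | value β P ∈ integers}).encard : ENNReal) := by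
  refine (ENNReal.tsum_le_tsum fun P ↦ integersInOrbit_le_one P.2.1).trans ?_
  rw [ENNReal.tsum_add]
  gcongr
  · exact ENNReal.tsum_comp_le_tsum_of_injective Subtype.val_injective _
  · rw [← ENNReal.tsum_set_one, tsum_subtype
      (goodParamsLE 3 cubicFamily β B ∩ {P | value β P ∈ integers}) (fun _ ↦ (1 : ENNReal)),
      tsum_subtype (goodParamsLE 3 cubicFamily β B)
        ({P | value β P ∈ integers}.indicator (1 : OnePoint ℚ → ENNReal)),
      Set.indicator_indicator]
    rfl

/-! ### The limit -/

/-- Every large real number lies between consecutive values of `C n ^ d`. -/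
lemma exists_nat_pow_le_lt {C y : ℝ} (hC : 0 < C) {d K : ℕ} (hd : d ≠ 0)
    (hy : C * K ^ d ≤ y) : ∃ n, K ≤ n ∧ C * n ^ d ≤ y ∧ y < C * (n + 1) ^ d := by
  have hex : ∃ n : ℕ, y < C * (n + 1) ^ d := by
    obtain ⟨n, hn⟩ := exists_nat_gt (y / C)
    refine ⟨n, ?_⟩
    rw [div_lt_iff₀' hC] at hn
    refine hn.trans_le ?_
    gcongr
    have : (1 : ℝ) ≤ n + 1 := by simp
    exact (le_add_of_nonneg_right zero_le_one).trans (le_self_pow₀ this hd)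
  classical
  have hmin (m : ℕ) (hm : m < Nat.find hex) : C * (m + 1) ^ d ≤ y :=
    not_lt.mp (Nat.find_min hex hm)
  have hK : K ≤ Nat.find hex := by
    by_contra! h
    refine (Nat.find_spec hex).not_ge (le_trans ?_ hy)
    gcongr
    exact_mod_cast h
  refine ⟨Nat.find hex, hK, ?_, Nat.find_spec hex⟩
  rcases hn : Nat.find hex with _ | m
  · have : K = 0 := by omega
    subst this
    exact hy
  · simpa using hmin m (by omega)

theorem average_cubicFamily {β : RatFunc ℚ} (hβ : 3 ≤ degree β) :
    average 3 cubicFamily β = 0 := by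
  have hd : degree β ≠ 0 := by omega
  obtain ⟨c, hc, C, hC, hbd⟩ := exists_expHeight_value_bounds β
  obtain ⟨A, hA⟩ := exists_ncard_value_mem_integers_le (β := β) (by omega)
  -- `L` is chosen so that `H(β_t) < C (n + 1)^d` implies `H(t) ≤ L n`.
  obtain ⟨L, hL⟩ := exists_nat_ge (C * 2 ^ degree β / c + 1)
  have hL1 : (1 : ℝ) ≤ L := le_trans (by simp; positivity) hL
  have hLd : C * 2 ^ degree β ≤ c * (L : ℝ) ^ degree β := by
    rw [← div_le_iff₀' hc]
    exact (by linarith : C * 2 ^ degree β / c ≤ L).trans (le_self_pow₀ hL1 hd)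
  set K := ∑' P, (exceptionalParams β).indicator
    (fun P ↦ (integersInOrbit 3 cubicFamily β P : ENNReal)) P with hK
  have hKtop : K ≠ ⊤ := tsum_exceptionalParams_ne_top hβ
  refine Tendsto.limsup_eq (ENNReal.tendsto_nhds_zero.mpr fun ε hε ↦ ?_)
  -- The numerator will be at most `(K + A L) n ≤ 3 (K + A L) (n / 2)` and the denominator at least
  -- `k (n / 2)`; hence `k ε > 3 (K + A L)`.
  obtain ⟨k, hk⟩ := ENNReal.exists_nat_mul_gt hε.ne'
    (ENNReal.mul_ne_top (ENNReal.natCast_ne_top 3)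
      (ENNReal.add_ne_top.mpr ⟨hKtop, ENNReal.natCast_ne_top (A * L)⟩))
  -- This makes `n ≥ 2^k + 2`: the power allows `k` denominators in the count, and `n ≥ 2` gives `n
  -- ≤ 3 (n / 2)` despite the floor.
  filter_upwards [Real.tendsto_exp_atTop.eventually_ge_atTop
    (C * ((2 ^ k + 2 : ℕ) : ℝ) ^ degree β)] with B hB
  obtain ⟨n, hn, hn1, hn2⟩ := exists_nat_pow_le_lt hC hd hB
  have h2k : 0 < 2 ^ k := by positivity
  have hn0 : 1 ≤ n := by omega
  have hn0' : (1 : ℝ) ≤ n := by exact_mod_cast hn0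
  set S := goodParamsLE 3 cubicFamily β B with hS
  have hSfin : S.Finite := finite_goodParamsLE_cubicFamily (by omega) B
  have hnum : ((S ∩ {P | value β P ∈ integers}).encard : ENNReal) ≤ ((A * L * n : ℕ) : ENNReal) := by
    have hsub : S ∩ {P | value β P ∈ integers} ⊆ ((↑) : ℚ → OnePoint ℚ) ''
        {t : ℚ | Height.mulHeight₁ t ≤ (L * n : ℕ) ∧ value β (t : OnePoint ℚ) ∈ integers} := by
      rintro P ⟨hP, hint⟩
      obtain ⟨t, -, rfl⟩ := mem_goodParams_cubicFamily.mp hP.1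
      refine ⟨t, ⟨?_, hint⟩, rfl⟩
      have h1 := mulHeight_pow_le_of_mem_goodParamsLE hc (fun t ↦ (hbd t).1) hP
      rw [le_div_iff₀' hc] at h1
      have h2 : c * Height.mulHeight₁ t ^ degree β ≤ c * ((L * n : ℕ) : ℝ) ^ degree β := by
        calc _ ≤ C * ((n : ℝ) + 1) ^ degree β := h1.trans hn2.le
          _ ≤ C * (2 * (n : ℝ)) ^ degree β := by gcongr; linarith
          _ = C * 2 ^ degree β * (n : ℝ) ^ degree β := by ring
          _ ≤ c * (L : ℝ) ^ degree β * (n : ℝ) ^ degree β := by gcongr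
          _ = _ := by push_cast; ring
      exact le_of_pow_le_pow_left₀ hd (by positivity) (le_of_mul_le_mul_left h2 hc)
    have hfin : {t : ℚ | Height.mulHeight₁ t ≤ (L * n : ℕ) ∧
        value β (t : OnePoint ℚ) ∈ integers}.Finite :=
      (NumberField.finite_setOfPred_mulHeight₁_le ℚ _).subset fun t ht ↦ ht.1
    have hL1' : 1 ≤ L := by exact_mod_cast hL1
    have h3 := (Set.ncard_le_ncard hsub (hfin.image _)).trans
      ((Set.ncard_image_le hfin).trans (hA (L * n) (Nat.mul_pos hL1' hn0)))
    rw [← (hSfin.subset Set.inter_subset_left).cast_ncard_eq]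
    rw [mul_assoc]
    exact_mod_cast h3
  have hden : ((k * (n / 2) : ℕ) : ENNReal) ≤ (S.encard : ENNReal) := by
    have hsub : ((↑) : ℚ → OnePoint ℚ) '' {t : ℚ | Height.mulHeight₁ t ≤ n ∧ t ≠ -1} ⊆ S := by
      rintro _ ⟨t, ⟨ht, ht1⟩, rfl⟩
      refine ⟨mem_goodParams_cubicFamily.mpr ⟨t, ht1, rfl⟩, (height_le_iff _ _).mpr ?_⟩
      refine (hbd t).2.trans (le_trans ?_ hn1)
      gcongr
    have h3 := (mul_half_le_ncard_mulHeight_le (k := k) (n := n) (by omega)).trans_eq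
      (Set.ncard_image_of_injective _ OnePoint.coe_injective).symm
    rw [← hSfin.cast_ncard_eq]
    exact_mod_cast h3.trans (Set.ncard_le_ncard hsub hSfin)
  refine ENNReal.div_le_of_le_mul ?_
  have hn3 : n ≤ 3 * (n / 2) := by omega
  calc _ ≤ K + ((S ∩ {P | value β P ∈ integers}).encard : ENNReal) := tsum_integersInOrbit_le β B
    _ ≤ K * n + ((A * L * n : ℕ) : ENNReal) := by
      gcongr
      exact le_mul_of_one_le_right' (by exact_mod_cast hn0)
    _ = (K + (A * L : ℕ)) * (n : ℕ) := by push_cast; ring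
    _ ≤ (K + (A * L : ℕ)) * ((3 * (n / 2) : ℕ) : ENNReal) := by gcongr
    _ = ((3 : ℕ) * (K + (A * L : ℕ))) * ((n / 2 : ℕ) : ENNReal) := by push_cast; ring
    _ ≤ (k * ε) * ((n / 2 : ℕ) : ENNReal) := by gcongr
    _ = ε * ((k * (n / 2) : ℕ) : ENNReal) := by push_cast; ring
    _ ≤ ε * (S.encard : ENNReal) := by gcongr

end OrbitAverage

theorem mainTheorem5 :
    OrbitAverage.goodParams 3 OrbitAverage.cubicFamily = {((-1 : ℚ) : OnePoint ℚ), ∞}ᶜ ∧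
    ∀ β : RatFunc ℚ, 3 ≤ OrbitAverage.degree β →
      (∀ B : ℝ, (OrbitAverage.goodParamsLE 3 OrbitAverage.cubicFamily β B).Finite) ∧
      OrbitAverage.average 3 OrbitAverage.cubicFamily β = 0 :=
  ⟨OrbitAverage.goodParams_cubicFamily, fun _ hβ ↦
    ⟨OrbitAverage.finite_goodParamsLE_cubicFamily (by omega),
      OrbitAverage.average_cubicFamily hβ⟩⟩
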